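/- Identify $\mathbb R^2$ with $\mathbb C$, and let $\mathcal M$ be the set of all norms on the real vector space $\mathbb R^2$. For $X\in\mathcal M$ write $B_X=\{v:\|v\|_X\le 1\}$ and $\partial B_X=\{v:\|v\|_X=1\}$, and define $\varpi(X)=\tfrac12\,\mathrm{len}_X(\partial B_X)$, where $\mathrm{len}_X(\partial B_X)\in[0,\infty]$ is the length of the loop $\partial B_X$ (traversed once around the origin) with respect to the metric $d_X(u,v)=\|u-v\|_X$, i.e. the supremum of $\sum_{j=1}^n\|x_j-x_{j-1}\|_X$ over all finite sequences $x_0,x_1,\dots,x_n=x_0$ of points occurring in this order along the loop. For a linear isomorphism $T:\mathbb R^2\to\mathbb R^2$ the push-forward norm $TX$ is given by $\|v\|_{TX}=\|T^{-1}v\|_X$; two norms $X,Y$ are linearly equivalent if $TX=Y$ for some linear isomorphism $T$. Let $iX$ be the push-forward of $X$ under the quarter-turn $z\mapsto iz$, let $$\mathcal Q=\{Y\in\mathcal M: Y\text{ is linearly equivalent to some }X\in\mathcal M\text{ with }iX=X\},$$ and let $\mathcal E\subset\mathcal M$ be the set of Euclidean norms, i.e. those of the form $\|v\|_X=\sqrt{\langle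 v,v\rangle}$ for an inner product $\langle\cdot,\cdot\rangle$ on $\mathbb R^2$. **Proposition 3.3.** (a) For any norm $X\in\mathcal M$ such that $iX=X$, we have $\varpi(X)\ge\pi$. Moreover, for such $X$, $\varpi(X)=\pi$ if and only if $X$ is a positive multiple of the $\ell^2$ norm, i.e. there is $c>0$ with $\|v\|_X=c\,|v|$ for all $v$. (b) $\varpi(\mathcal Q)=[\pi,4]$ and $\mathcal E=\{X\in\mathcal Q:\varpi(X)=\pi\}$. -/

import Mathlib

/-- A norm on the real plane `ℝ² = ℂ`: a real seminorm that vanishes only at the origin. -/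
structure PlaneNorm extends Seminorm ℝ ℂ where
  eq_zero_of_map_eq_zero' : ∀ v : ℂ, toFun v = 0 → v = 0

namespace PlaneNorm

noncomputable instance : CoeFun PlaneNorm (fun _ => ℂ → ℝ) := ⟨fun X => X.toSeminorm⟩

@[ext]
theorem ext {X Y : PlaneNorm} (h : ∀ v : ℂ, X v = Y v) : X = Y := by
  cases X; cases Y
  congr
  exact Seminorm.ext h

theorem pos (X : PlaneNorm) {v : ℂ} (hv : v ≠ 0) : 0 < X v :=
  lt_of_le_of_ne (apply_nonneg X.toSeminorm v)
    (fun h => hv (X.eq_zero_of_map_eq_zero' v h.symm))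

/-- The metric `d_X(u, v) = ‖u - v‖_X`, as an extended distance. -/
noncomputable abbrev metric (X : PlaneNorm) : PseudoEMetricSpace ℂ where
  edist u v := ENNReal.ofReal (X (u - v))
  edist_self u := by
    have h : X (u - u) = 0 := by rw [sub_self]; exact map_zero X.toSeminorm
    rw [h, ENNReal.ofReal_zero]
  edist_comm u v := by
    have h : X (u - v) = X (v - u) := map_sub_rev X.toSeminorm u v
    rw [h]
  edist_triangle u v w := by
    rw [← ENNReal.ofReal_add (apply_nonneg X.toSeminorm _) (apply_nonneg X.toSeminorm _)]
    exact ENNReal.ofReal_le_ofReal (le_map_sub_add_map_sub X.toSeminorm u v w)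

/-- The length of the path `φ : [a, b] → ℂ` with respect to `d_X`: the supremum in `[0, ∞]` of
`∑ d_X(φ(t_{i-1}), φ(t_i))` over all finite partitions, that is, the total variation of `φ`. -/
noncomputable def len (X : PlaneNorm) (φ : ℝ → ℂ) (a b : ℝ) : ENNReal :=
  @eVariationOn ℝ _ ℂ X.metric φ (Set.Icc a b)

/-- The unit sphere `∂B_X`. -/
def sphere (X : PlaneNorm) : Set ℂ := {v | X v = 1}

/-- The unit sphere `∂B_X` as a loop, parametrized by the argument `t ∈ [0, 2π]`: the unique
point of `∂B_X` on the ray from the origin in the direction `e^{it}`. -/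
noncomputable def sphereLoop (X : PlaneNorm) (t : ℝ) : ℂ :=
  (X (Complex.exp (t * Complex.I)))⁻¹ • Complex.exp (t * Complex.I)

theorem sphereLoop_mem_sphere (X : PlaneNorm) (t : ℝ) : X.sphereLoop t ∈ X.sphere := by
  have h := X.pos (Complex.exp_ne_zero (t * Complex.I))
  have h2 : X (X.sphereLoop t) = ‖(X (Complex.exp (t * Complex.I)))⁻¹‖ *
      X (Complex.exp (t * Complex.I)) := map_smul_eq_mul X.toSeminorm _ _
  rw [Real.norm_of_nonneg (inv_nonneg.mpr h.le), inv_mul_cancel₀ h.ne'] at h2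
  exact h2

theorem sphereLoop_arg (X : PlaneNorm) {v : ℂ} (hv : v ∈ X.sphere) :
    X.sphereLoop v.arg = v := by
  have hv1 : X v = 1 := hv
  have h0 : v ≠ 0 := by
    rintro rfl
    have h : X (0 : ℂ) = 0 := map_zero X.toSeminorm
    rw [h] at hv1
    exact zero_ne_one hv1
  have hn : ‖v‖ ≠ 0 := norm_ne_zero_iff.mpr h0
  have he : Complex.exp (v.arg * Complex.I) = ‖v‖⁻¹ • v := by
    conv_rhs => rw [← Complex.norm_mul_exp_arg_mul_I v]
    rw [Complex.real_smul, Complex.norm_mul_exp_arg_mul_I v]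
    have h := Complex.norm_mul_exp_arg_mul_I v
    have hn' : (‖v‖ : ℂ) ≠ 0 := by exact_mod_cast hn
    push_cast
    field_simp
    rw [mul_comm]; exact h
  have h2 : X (‖v‖⁻¹ • v) = ‖‖v‖⁻¹‖ * X v := map_smul_eq_mul X.toSeminorm _ _
  unfold sphereLoop
  rw [he, h2, hv1, mul_one, norm_inv, norm_norm, inv_inv, smul_smul, mul_inv_cancel₀ hn, one_smul]

theorem sphereLoop_periodic (X : PlaneNorm) : Function.Periodic X.sphereLoop (2 * Real.pi) := by
  intro t
  have h : Complex.exp (((t + 2 * Real.pi : ℝ) : ℂ) * Complex.I) =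
      Complex.exp (t * Complex.I) := by
    push_cast
    rw [add_mul, Complex.exp_add, Complex.exp_two_pi_mul_I, mul_one]
  unfold sphereLoop
  rw [h]

/-- The loop runs through the whole of `∂B_X`. -/
theorem sphereLoop_image (X : PlaneNorm) :
    X.sphereLoop '' Set.Ico 0 (2 * Real.pi) = X.sphere := by
  apply Set.Subset.antisymm
  · rintro _ ⟨t, -, rfl⟩
    exact X.sphereLoop_mem_sphere t
  · intro v hv
    obtain ⟨t, ht, h⟩ := X.sphereLoop_periodic.exists_mem_Ico₀ Real.two_pi_pos v.arg
    exact ⟨t, ht, h ▸ X.sphereLoop_arg hv⟩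

/-- The loop passes through each point of `∂B_X` only once. -/
theorem sphereLoop_injOn (X : PlaneNorm) :
    Set.InjOn X.sphereLoop (Set.Ico 0 (2 * Real.pi)) := by
  intro s hs t ht h
  have hpos (r : ℝ) : 0 < (X (Complex.exp (r * Complex.I)))⁻¹ :=
    inv_pos.mpr (X.pos (Complex.exp_ne_zero _))
  have h1 : ‖X.sphereLoop s‖ = ‖X.sphereLoop t‖ := by rw [h]
  have h2 : Complex.exp (s * Complex.I) = Complex.exp (t * Complex.I) := by
    unfold sphereLoop at h h1
    rw [norm_smul, norm_smul, Complex.norm_exp_ofReal_mul_I, Complex.norm_exp_ofReal_mul_I,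
      mul_one, mul_one, Real.norm_of_nonneg (hpos s).le, Real.norm_of_nonneg (hpos t).le] at h1
    rw [h1] at h
    exact smul_right_injective ℂ (hpos t).ne' h
  obtain ⟨n, hn⟩ := Complex.exp_eq_exp_iff_exists_int.mp h2
  have h3 : s = t + n * (2 * Real.pi) := by
    have := congrArg Complex.im hn
    simpa using this
  have hp := Real.two_pi_pos
  have hn1 : (n : ℝ) < 1 := by
    by_contra hc
    nlinarith [hs.2, ht.1, not_lt.mp hc]
  have hn2 : (-1 : ℝ) < n := by
    by_contra hc
    nlinarith [hs.1, ht.2, not_lt.mp hc]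
  have hn0 : n = 0 := by
    have ha : n < 1 := by exact_mod_cast hn1
    have hb : -1 < n := by exact_mod_cast hn2
    omega
  rw [h3, hn0]
  simp

/-- `ϖ(X) = len_X(∂B_X) / 2`, as an element of `[0, ∞]`. -/
noncomputable def varpi (X : PlaneNorm) : ENNReal :=
  X.len X.sphereLoop 0 (2 * Real.pi) / 2

/-- The push-forward norm `TX`, given by `‖v‖_{TX} = ‖T⁻¹ v‖_X`. -/
noncomputable def pushforward (T : ℂ ≃ₗ[ℝ] ℂ) (X : PlaneNorm) : PlaneNorm where
  toSeminorm := X.toSeminorm.comp T.symm.toLinearMap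
  eq_zero_of_map_eq_zero' v h :=
    T.symm.map_eq_zero_iff.mp (X.eq_zero_of_map_eq_zero' (T.symm v) h)

/-- Two norms are linearly equivalent if some linear isomorphism pushes one to the other. -/
def LinearlyEquivalent (X Y : PlaneNorm) : Prop :=
  ∃ T : ℂ ≃ₗ[ℝ] ℂ, pushforward T X = Y

/-- The counter-clockwise quarter-turn `z ↦ iz`. -/
noncomputable def quarterTurn : ℂ ≃ₗ[ℝ] ℂ where
  toFun z := Complex.I * z
  invFun z := -Complex.I * z
  map_add' z w := mul_add _ _ _
  map_smul' c z := mul_smul_comm _ _ _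
  left_inv z := by simp [← mul_assoc]
  right_inv z := by simp [← mul_assoc]

/-- `X` has quarter-turn symmetry: `iX = X`. -/
def HasQuarterTurnSymmetry (X : PlaneNorm) : Prop :=
  pushforward quarterTurn X = X

/-- The class `𝒬` of norms linearly equivalent to a norm with quarter-turn symmetry. -/
def quarterTurnClass : Set PlaneNorm :=
  {Y | ∃ X : PlaneNorm, X.HasQuarterTurnSymmetry ∧ LinearlyEquivalent Y X}

/-- The `ℓ²` norm on `ℝ² = ℂ`, that is, the absolute value. -/
noncomputable def l2 : PlaneNorm where
  toSeminorm := normSeminorm ℝ ℂ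
  eq_zero_of_map_eq_zero' _ h := norm_eq_zero.mp h

/-- The Euclidean norms: those of the form `v ↦ √⟨v, v⟩` for an inner product
`⟨·, ·⟩` on `ℝ²`. -/
def euclideanNorms : Set PlaneNorm :=
  {X | ∃ B : LinearMap.BilinForm ℝ ℂ, (∀ u v : ℂ, B u v = B v u) ∧
    (∀ v : ℂ, v ≠ 0 → 0 < B v v) ∧ ∀ v : ℂ, X v = Real.sqrt (B v v)}

end PlaneNorm

namespace PlaneNorm

/-! Write g(t) = X(e^{it}), so that the unit sphere is γ(t) = e^{it}/g(t). Lower bound: g is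
Lipschitz, hence differentiable almost everywhere, and there γ' = g⁻² · i · e^{it}(g + ig'). The
symmetry iX = X removes the factor i, and the tangent functional of the norm at e^{it} gives
X(e^{it}(x + iy)) ≥ xg + yg'. Taking x = g and y = g' yields X(γ') ≥ 1 + (g'/g)². Integrating over
[0, 2π] gives ϖ ≥ π; equality forces g' = 0 almost everywhere, so g is constant. See
`mul_add_mul_le_of_hasDerivAt`, `one_add_sq_le_of_hasDerivAt` and `two_pi_le_of_sphereLoop_le`.

Upper bound: rotate and scale so that X(1) = X(i) = 1 and |v| ≤ X(v). Then both coordinates are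
monotone along the first-quadrant arc, so that arc has length at most 2, and ϖ is twice its length
(`len_quarter_le_two`).

A linear isomorphism carries sphere to sphere isometrically, up to a monotone change of angle, so ϖ
is a linear invariant and the bounds pass to 𝒬. All values in [π, 4] occur because ϖ is continuous
along the segment from ℓ² to ℓ¹. The Euclidean norms are the linear images of ℓ², which identifies
them with the equality case. -/

theorem nonneg (X : PlaneNorm) (v : ℂ) : 0 ≤ X v := apply_nonneg X.toSeminorm v

theorem map_smul (X : PlaneNorm) (c : ℝ) (v : ℂ) : X (c • v) = |c| * X v :=
  map_smul_eq_mul X.toSeminorm c v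

theorem add_le (X : PlaneNorm) (u v : ℂ) : X (u + v) ≤ X u + X v :=
  map_add_le_add X.toSeminorm u v

theorem map_neg (X : PlaneNorm) (v : ℂ) : X (-v) = X v := map_neg_eq_map X.toSeminorm v

theorem map_sub_comm (X : PlaneNorm) (u v : ℂ) : X (u - v) = X (v - u) :=
  map_sub_rev X.toSeminorm u v

/-! ### Length of paths: comparison, additivity, reparametrization -/

/-- The common comparison principle: each partition sum splits into K times a sum for φ and a
telescoping sum for M. Isometries use K = 1 and constant M, coordinatewise bounds use K = 0, and
perturbation of the norm uses both terms. -/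
theorem len_le_of_forall (X Y : PlaneNorm) {φ ψ : ℝ → ℂ} {M : ℝ → ℝ} {a b K : ℝ} (hab : a ≤ b)
    (hM : MonotoneOn M (Set.Icc a b)) (hK : 0 ≤ K)
    (h : ∀ s ∈ Set.Icc a b, ∀ t ∈ Set.Icc a b, s ≤ t →
      Y (ψ t - ψ s) ≤ K * X (φ t - φ s) + (M t - M s)) :
    Y.len ψ a b ≤ ENNReal.ofReal K * X.len φ a b + ENNReal.ofReal (M b - M a) := by
  refine iSup_le ?_
  rintro ⟨n, u, hu, us⟩
  have h1 : ∀ i, ENNReal.ofReal (Y (ψ (u (i + 1)) - ψ (u i))) ≤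
      ENNReal.ofReal K * ENNReal.ofReal (X (φ (u (i + 1)) - φ (u i))) +
        ENNReal.ofReal (M (u (i + 1)) - M (u i)) := by
    intro i
    have hle := hu (Nat.le_succ i)
    rw [← ENNReal.ofReal_mul hK, ← ENNReal.ofReal_add (mul_nonneg hK (X.nonneg _))
      (sub_nonneg.2 (hM (us i) (us (i + 1)) hle))]
    exact ENNReal.ofReal_le_ofReal (h _ (us i) _ (us (i + 1)) hle)
  refine (Finset.sum_le_sum fun i _ => h1 i).trans ?_
  rw [Finset.sum_add_distrib, ← Finset.mul_sum]
  gcongr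
  · exact @eVariationOn.sum_le _ _ _ X.metric φ _ n u hu us
  · rw [← ENNReal.ofReal_sum_of_nonneg
      (fun i _ => sub_nonneg.2 (hM (us i) (us (i + 1)) (hu (Nat.le_succ i)))),
      Finset.sum_range_sub (fun i => M (u i))]
    refine ENNReal.ofReal_le_ofReal ?_
    have h2 := hM (us n) (Set.right_mem_Icc.2 hab) (us n).2
    have h3 := hM (Set.left_mem_Icc.2 hab) (us 0) (us 0).1
    linarith

theorem len_le_len (X Y : PlaneNorm) {φ ψ : ℝ → ℂ} {a b : ℝ} (hab : a ≤ b)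
    (h : ∀ s t, Y (ψ t - ψ s) ≤ X (φ t - φ s)) : Y.len ψ a b ≤ X.len φ a b := by
  have := len_le_of_forall X Y (φ := φ) (ψ := ψ) (M := fun _ => 0) (K := 1) hab
    (fun _ _ _ _ _ => le_rfl) zero_le_one (fun s _ t _ _ => by simpa using h s t)
  simpa using this

theorem len_eq_len (X Y : PlaneNorm) {φ ψ : ℝ → ℂ} {a b : ℝ} (hab : a ≤ b)
    (h : ∀ s t, Y (ψ t - ψ s) = X (φ t - φ s)) : Y.len ψ a b = X.len φ a b :=
  le_antisymm (len_le_len X Y hab fun s t => (h s t).le)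
    (len_le_len Y X hab fun s t => (h s t).ge)

theorem len_le_of_monotoneOn (X : PlaneNorm) {φ : ℝ → ℂ} {M : ℝ → ℝ} {a b : ℝ} (hab : a ≤ b)
    (hM : MonotoneOn M (Set.Icc a b))
    (h : ∀ s ∈ Set.Icc a b, ∀ t ∈ Set.Icc a b, s ≤ t → X (φ t - φ s) ≤ M t - M s) :
    X.len φ a b ≤ ENNReal.ofReal (M b - M a) := by
  have := len_le_of_forall X X (φ := φ) (ψ := φ) (M := M) (K := 0) hab hM le_rfl
    (fun s hs t ht hst => by simpa using h s hs t ht hst)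
  simpa using this

theorem le_len (X : PlaneNorm) (φ : ℝ → ℂ) {a b : ℝ} (hab : a ≤ b) :
    ENNReal.ofReal (X (φ b - φ a)) ≤ X.len φ a b :=
  @eVariationOn.edist_le _ _ _ X.metric φ _ b a (Set.right_mem_Icc.2 hab) (Set.left_mem_Icc.2 hab)

theorem len_add (X : PlaneNorm) (φ : ℝ → ℂ) {a b c : ℝ} (hab : a ≤ b) (hbc : b ≤ c) :
    X.len φ a b + X.len φ b c = X.len φ a c := by
  have := @eVariationOn.Icc_add_Icc _ _ _ X.metric φ Set.univ a b c hab hbc (Set.mem_univ _)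
  rwa [Set.univ_inter, Set.univ_inter, Set.univ_inter] at this

theorem len_self (X : PlaneNorm) (φ : ℝ → ℂ) (a : ℝ) : X.len φ a a = 0 := by
  have := len_le_of_monotoneOn X (φ := φ) (M := fun _ => 0) (le_refl a) (fun _ _ _ _ _ => le_rfl)
    (fun s hs t ht _ => by
      have h1 : s = a := le_antisymm hs.2 hs.1
      have h2 : t = a := le_antisymm ht.2 ht.1
      have h3 : X (0 : ℂ) = 0 := map_zero X.toSeminorm
      rw [h1, h2, sub_self, h3]; simp)
  simpa using this

theorem len_comp_le_of_monotoneOn (X : PlaneNorm) (f : ℝ → ℂ) {φ : ℝ → ℝ} {a b c d : ℝ}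
    (hφ : MonotoneOn φ (Set.Icc a b)) (hm : Set.MapsTo φ (Set.Icc a b) (Set.Icc c d)) :
    X.len (f ∘ φ) a b ≤ X.len f c d :=
  @eVariationOn.comp_le_of_monotoneOn _ _ _ X.metric _ _ f _ _ φ hφ hm

theorem len_comp_le_of_antitoneOn (X : PlaneNorm) (f : ℝ → ℂ) {φ : ℝ → ℝ} {a b c d : ℝ}
    (hφ : AntitoneOn φ (Set.Icc a b)) (hm : Set.MapsTo φ (Set.Icc a b) (Set.Icc c d)) :
    X.len (f ∘ φ) a b ≤ X.len f c d :=
  @eVariationOn.comp_le_of_antitoneOn _ _ _ X.metric _ _ f _ _ φ hφ hm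

theorem len_shift_le (X : PlaneNorm) (f : ℝ → ℂ) {a b : ℝ} (c : ℝ) :
    X.len (fun t => f (t + c)) a b ≤ X.len f (a + c) (b + c) :=
  len_comp_le_of_monotoneOn X f (φ := fun t => t + c)
    (fun _ _ _ _ h => add_le_add_left h c)
    (fun _ h => ⟨by linarith [h.1], by linarith [h.2]⟩)

theorem len_shift (X : PlaneNorm) (f : ℝ → ℂ) {a b : ℝ} (c : ℝ) :
    X.len (fun t => f (t + c)) a b = X.len f (a + c) (b + c) := by
  refine le_antisymm (len_shift_le X f c) ?_
  have := len_shift_le X (fun t => f (t + c)) (a := a + c) (b := b + c) (-c)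
  simpa using this

/-- A path that repeats itself after time `c` up to an isometry has the same length on all
intervals of length `c`. -/
theorem len_period (X : PlaneNorm) {f : ℝ → ℂ} {c : ℝ} (hc : 0 < c)
    (hf : ∀ s t, X (f (t + c) - f (s + c)) = X (f t - f s)) (a : ℝ) :
    X.len f a (a + c) = X.len f 0 c := by
  have hs : ∀ a b : ℝ, a ≤ b → X.len f (a + c) (b + c) = X.len f a b := fun a b hab => by
    rw [← len_shift]; exact len_eq_len X X hab hf
  have hp : Function.Periodic (fun a => X.len f a (a + c)) c := fun a =>
    hs a (a + c) (by linarith)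
  obtain ⟨b, hb, h⟩ := hp.exists_mem_Ico₀ hc a
  have h0 := hs 0 b hb.1
  rw [zero_add] at h0
  refine h.trans ?_
  rw [← len_add X f hb.2.le (by linarith [hb.1] : c ≤ b + c), h0, add_comm,
    len_add X f hb.1 hb.2.le]

/-! ### Symmetries and rays of the unit sphere -/

theorem sphereLoop_add (X : PlaneNorm) {c : ℝ} {w : ℂ} (hw : Complex.exp (c * Complex.I) = w)
    (hX : ∀ v, X (w * v) = X v) (t : ℝ) : X.sphereLoop (t + c) = w * X.sphereLoop t := by
  have h : Complex.exp (((t + c : ℝ) : ℂ) * Complex.I) = w * Complex.exp (t * Complex.I) := by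
    rw [← hw, ← Complex.exp_add]; push_cast; ring_nf
  unfold sphereLoop
  rw [h, hX, mul_smul_comm]

theorem sphereLoop_add_pi (X : PlaneNorm) (t : ℝ) :
    X.sphereLoop (t + Real.pi) = -X.sphereLoop t := by
  rw [sphereLoop_add X Complex.exp_pi_mul_I (fun v => by rw [neg_one_mul, map_neg]), neg_one_mul]

/-- Central symmetry makes the loop repeat itself isometrically after angle π, so the starting angle
of the half-turn is free. -/
theorem varpi_eq_len (X : PlaneNorm) (a : ℝ) :
    X.varpi = X.len X.sphereLoop a (a + Real.pi) := by
  have hp := Real.pi_pos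
  have hper : ∀ s t, X (X.sphereLoop (t + Real.pi) - X.sphereLoop (s + Real.pi)) =
      X (X.sphereLoop t - X.sphereLoop s) := fun s t => by
    rw [sphereLoop_add_pi, sphereLoop_add_pi, neg_sub_neg, map_sub_comm]
  have h := len_period X hp hper
  unfold varpi
  rw [h a, ← len_add X _ hp.le (by linarith : Real.pi ≤ 2 * Real.pi),
    two_mul Real.pi, h Real.pi, ← two_mul, ENNReal.mul_div_right_comm,
    ENNReal.div_self two_ne_zero ENNReal.ofNat_ne_top, one_mul]

theorem sphereLoop_of_ray (X : PlaneNorm) {t r : ℝ} (hr : 0 < r) {w : ℂ}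
    (hw : w = r • Complex.exp (t * Complex.I)) : X.sphereLoop t = (X w)⁻¹ • w := by
  rw [hw, map_smul, abs_of_pos hr, smul_smul, mul_inv, mul_comm r⁻¹, mul_assoc,
    inv_mul_cancel₀ hr.ne', mul_one]
  rfl

theorem pushforward_apply (T : ℂ ≃ₗ[ℝ] ℂ) (X : PlaneNorm) (v : ℂ) :
    pushforward T X (T v) = X v :=
  congrArg X (T.symm_apply_apply v)

theorem pushforward_symm_pushforward (T : ℂ ≃ₗ[ℝ] ℂ) (X : PlaneNorm) :
    pushforward T.symm (pushforward T X) = X :=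
  ext fun v => pushforward_apply T X v

/-! ### Linear invariance of ϖ -/

/-- The imaginary part is |w||z| sin(arg z - arg w). With z in the closed upper half-plane, arg w >
arg z would put the difference in [-π, 0), where the sine is nonpositive. -/
theorem arg_le_arg_of_im_pos {w z : ℂ} (hz : 0 ≤ z.im)
    (h : 0 < ((starRingEnd ℂ) w * z).im) : w.arg ≤ z.arg := by
  by_contra hc
  push Not at hc
  have h1 : ((starRingEnd ℂ) w * z).im = ‖w‖ * ‖z‖ * Real.sin (z.arg - w.arg) := by
    rw [Real.sin_sub]
    have a1 := Complex.norm_mul_cos_arg w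
    have a2 := Complex.norm_mul_sin_arg w
    have a3 := Complex.norm_mul_cos_arg z
    have a4 := Complex.norm_mul_sin_arg z
    simp only [Complex.mul_im, Complex.conj_re, Complex.conj_im]
    rw [← a1, ← a2, ← a3, ← a4]
    ring
  have h2 := Complex.arg_nonneg_iff.2 hz
  have h3 := Complex.arg_le_pi w
  have h4 : Real.sin (z.arg - w.arg) ≤ 0 :=
    Real.sin_nonpos_of_nonpos_of_neg_pi_le (by linarith) (by linarith)
  have h5 := mul_nonneg (norm_nonneg w) (norm_nonneg z)
  nlinarith

theorem im_conj_exp_mul_exp (s t : ℝ) :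
    ((starRingEnd ℂ) (Complex.exp (s * Complex.I)) * Complex.exp (t * Complex.I)).im =
      Real.sin (t - s) := by
  rw [← Complex.exp_conj, ← Complex.exp_add]
  simp only [map_mul, Complex.conj_ofReal, Complex.conj_I]
  rw [show (s : ℂ) * -Complex.I + t * Complex.I = ((t - s : ℝ) : ℂ) * Complex.I by
    push_cast; ring, Complex.exp_ofReal_mul_I_im]

/-- The change of angle need not be onto: only an inequality is sought, and the inverse isomorphism
supplies the reverse one. -/
theorem varpi_le_of_reparam {X Y : PlaneNorm} {T : ℂ ≃ₗ[ℝ] ℂ} (hT : ∀ v, Y (T v) = X v)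
    {φ : ℝ → ℝ} {a : ℝ}
    (hφ : MonotoneOn φ (Set.Icc 0 Real.pi) ∨ AntitoneOn φ (Set.Icc 0 Real.pi))
    (hm : Set.MapsTo φ (Set.Icc 0 Real.pi) (Set.Icc a (a + Real.pi)))
    (h : ∀ s, T (X.sphereLoop s) = Y.sphereLoop (φ s)) : X.varpi ≤ Y.varpi := by
  have h1 : X.len X.sphereLoop 0 Real.pi = Y.len (Y.sphereLoop ∘ φ) 0 Real.pi :=
    len_eq_len Y X Real.pi_pos.le fun s t => by
      simp only [Function.comp]
      rw [← h, ← h, ← map_sub, hT]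
  rw [varpi_eq_len X 0, varpi_eq_len Y a, zero_add, h1]
  rcases hφ with hφ | hφ
  · exact len_comp_le_of_monotoneOn Y _ hφ hm
  · exact len_comp_le_of_antitoneOn Y _ hφ hm

theorem map_sphereLoop {X Y : PlaneNorm} {T : ℂ ≃ₗ[ℝ] ℂ} (hT : ∀ v, Y (T v) = X v) {s t r : ℝ}
    (hr : 0 < r) (h : T (Complex.exp (s * Complex.I)) = r • Complex.exp (t * Complex.I)) :
    T (X.sphereLoop s) = Y.sphereLoop t := by
  rw [sphereLoop_of_ray Y hr h, hT]
  exact T.map_smul _ _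

theorem varpi_le_pushforward_of_pos (X : PlaneNorm) (T : ℂ ≃ₗ[ℝ] ℂ) {δ : ℝ} (hδ : 0 < δ)
    (h : ∀ u v, ((starRingEnd ℂ) (T u) * T v).im = δ * ((starRingEnd ℂ) u * v).im) :
    X.varpi ≤ (pushforward T X).varpi := by
  have hT := pushforward_apply T X
  have hne : ∀ v, v ≠ 0 → T v ≠ 0 := fun v hv => by simpa using hv
  -- Rotating the image by -a puts the image of 1 on the positive real axis. Since T preserves
  -- orientation, the upper half-circle then stays in the closed upper half-plane, and `arg` has no
  -- branch jump there.
  set a := (T 1).arg with ha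
  set S : ℝ → ℂ := fun s => T (Complex.exp (s * Complex.I)) * Complex.exp (-(a * Complex.I)) with hS
  have hTS : ∀ s : ℝ, T (Complex.exp (s * Complex.I)) = S s * Complex.exp (a * Complex.I) := fun s => by
    rw [hS]
    simp only
    rw [mul_assoc, ← Complex.exp_add, neg_add_cancel, Complex.exp_zero, mul_one]
  have hS0 : S 0 = ‖T 1‖ := by
    rw [hS]
    simp only [Complex.ofReal_zero, zero_mul, Complex.exp_zero]
    conv_lhs => rw [← Complex.norm_mul_exp_arg_mul_I (T 1)]
    rw [mul_assoc, ← Complex.exp_add, ← ha, add_neg_cancel, Complex.exp_zero, mul_one]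
  clear hS
  clear_value S
  have hSS : ∀ s t, ((starRingEnd ℂ) (S s) * S t).im = δ * Real.sin (t - s) := fun s t => by
    rw [← im_conj_exp_mul_exp, ← h, hTS, hTS, map_mul, mul_mul_mul_comm, ← Complex.exp_conj,
      ← Complex.exp_add]
    simp only [map_mul, Complex.conj_ofReal, Complex.conj_I, mul_neg, neg_add_cancel,
      Complex.exp_zero, mul_one]
  have hn1 : 0 < ‖T 1‖ := norm_pos_iff.2 (hne 1 one_ne_zero)
  have him : ∀ s ∈ Set.Icc 0 Real.pi, 0 ≤ (S s).im := fun s hs => by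
    have h1 := hSS 0 s
    rw [hS0, Complex.conj_ofReal, Complex.im_ofReal_mul, sub_zero] at h1
    have h2 := mul_nonneg hδ.le (Real.sin_nonneg_of_nonneg_of_le_pi hs.1 hs.2)
    rw [← h1] at h2
    exact nonneg_of_mul_nonneg_right h2 hn1
  refine varpi_le_of_reparam hT (φ := fun s => a + (S s).arg) (a := a) (Or.inl ?_) ?_ ?_
  · intro s hs t ht hst
    refine add_le_add_right ?_ a
    rcases hst.eq_or_lt with rfl | hst
    · rfl
    -- The pair s = 0, t = π has sin(t - s) = 0, so the strict criterion fails; s = 0 is settled by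
    -- arg(S 0) = 0 instead.
    rcases hs.1.eq_or_lt with rfl | hs0
    · rw [hS0, Complex.arg_ofReal_of_nonneg (norm_nonneg _)]
      exact Complex.arg_nonneg_iff.2 (him t ht)
    · refine arg_le_arg_of_im_pos (him t ht) ?_
      rw [hSS]
      exact mul_pos hδ (Real.sin_pos_of_pos_of_lt_pi (by linarith) (by linarith [ht.2]))
  · intro s hs
    have h1 := Complex.arg_nonneg_iff.2 (him s hs)
    have h2 := Complex.arg_le_pi (S s)
    exact ⟨by linarith, by linarith⟩
  · intro s
    have hSn : S s ≠ 0 := fun h0 => hne _ (Complex.exp_ne_zero (s * Complex.I)) (by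
      rw [hTS, h0, zero_mul])
    refine map_sphereLoop hT (norm_pos_iff.2 hSn) ?_
    rw [hTS]
    conv_lhs => rw [← Complex.norm_mul_exp_arg_mul_I (S s)]
    rw [Complex.real_smul, mul_assoc, ← Complex.exp_add]
    push_cast
    ring_nf

theorem varpi_le_pushforward_conj (X : PlaneNorm) :
    X.varpi ≤ (pushforward Complex.conjAe.toLinearEquiv X).varpi := by
  have hT := pushforward_apply Complex.conjAe.toLinearEquiv X
  refine varpi_le_of_reparam hT (φ := fun s => -s) (a := -Real.pi) (Or.inr ?_) ?_ ?_
  · exact fun _ _ _ _ h => neg_le_neg h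
  · exact fun s hs => ⟨by linarith [hs.2], by linarith [hs.1]⟩
  · intro s
    refine map_sphereLoop hT one_pos ?_
    rw [one_smul]
    change (starRingEnd ℂ) _ = _
    rw [← Complex.exp_conj]
    simp

theorem im_conj_map_mul_map (T : ℂ ≃ₗ[ℝ] ℂ) (u v : ℂ) :
    ((starRingEnd ℂ) (T u) * T v).im =
      ((starRingEnd ℂ) (T 1) * T Complex.I).im * ((starRingEnd ℂ) u * v).im := by
  have h : ∀ w, T w = w.re • T 1 + w.im • T Complex.I := fun w => by
    rw [← T.map_smul, ← T.map_smul, ← map_add]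
    congr 1
    apply Complex.ext <;> simp
  rw [h u, h v]
  simp
  ring

/-- This quantity is the determinant of T; were it zero, evaluating the area form on the preimages
of 1 and i would give 1 = 0. -/
theorem im_conj_map_one_mul_map_I_ne_zero (T : ℂ ≃ₗ[ℝ] ℂ) :
    ((starRingEnd ℂ) (T 1) * T Complex.I).im ≠ 0 := by
  intro h0
  have h := im_conj_map_mul_map T (T.symm 1) (T.symm Complex.I)
  rw [h0] at h
  simp at h

theorem varpi_le_pushforward (T : ℂ ≃ₗ[ℝ] ℂ) (X : PlaneNorm) :
    X.varpi ≤ (pushforward T X).varpi := by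
  rcases (im_conj_map_one_mul_map_I_ne_zero T).lt_or_gt with h | h
  -- Negative determinant: factor T through complex conjugation, which reverses the angle and leaves
  -- an orientation-preserving map.
  · refine (varpi_le_pushforward_conj X).trans
      ((varpi_le_pushforward_of_pos _ (Complex.conjAe.toLinearEquiv.trans T) (neg_pos.2 h)
        fun u v => ?_).trans_eq (congrArg varpi (ext fun v => ?_)))
    · rw [LinearEquiv.trans_apply, LinearEquiv.trans_apply, im_conj_map_mul_map]
      change _ * ((starRingEnd ℂ) ((starRingEnd ℂ) u) * (starRingEnd ℂ) v).im = _
      simp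
      ring
    · change X ((starRingEnd ℂ) ((starRingEnd ℂ) (T.symm v))) = X (T.symm v)
      rw [Complex.conj_conj]
  · exact varpi_le_pushforward_of_pos X T h (im_conj_map_mul_map T)

theorem varpi_pushforward (T : ℂ ≃ₗ[ℝ] ℂ) (X : PlaneNorm) :
    (pushforward T X).varpi = X.varpi :=
  le_antisymm ((varpi_le_pushforward T.symm _).trans_eq
    (congrArg varpi (pushforward_symm_pushforward T X))) (varpi_le_pushforward T X)

theorem LinearlyEquivalent.varpi_eq {X Y : PlaneNorm} (h : LinearlyEquivalent X Y) :
    X.varpi = Y.varpi := by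
  obtain ⟨T, rfl⟩ := h
  exact (varpi_pushforward T X).symm

/-! ### Quarter-turn symmetry and the upper bound 4 -/

theorem HasQuarterTurnSymmetry.map_I_mul {X : PlaneNorm} (h : X.HasQuarterTurnSymmetry) (v : ℂ) :
    X (Complex.I * v) = X v := by
  have h1 := pushforward_apply quarterTurn X v
  rw [h] at h1
  exact h1

theorem hasQuarterTurnSymmetry_of_forall {X : PlaneNorm} (h : ∀ v, X (Complex.I * v) = X v) :
    X.HasQuarterTurnSymmetry := ext fun v => by
  change X (-Complex.I * v) = X v
  rw [neg_mul, map_neg, h]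

theorem varpi_eq_two_mul_len {X : PlaneNorm} (h : ∀ v, X (Complex.I * v) = X v) :
    X.varpi = 2 * X.len X.sphereLoop 0 (Real.pi / 2) := by
  have hp := Real.pi_pos
  have he : Complex.exp (((Real.pi / 2 : ℝ) : ℂ) * Complex.I) = Complex.I := by
    push_cast; exact Complex.exp_pi_div_two_mul_I
  have hper : ∀ s t, X (X.sphereLoop (t + Real.pi / 2) - X.sphereLoop (s + Real.pi / 2)) =
      X (X.sphereLoop t - X.sphereLoop s) := fun s t => by
    rw [sphereLoop_add X he h, sphereLoop_add X he h, ← mul_sub, h]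
  have h1 := len_period X (half_pos hp) hper (Real.pi / 2)
  rw [add_halves] at h1
  rw [varpi_eq_len X 0, zero_add, ← len_add X _ (half_pos hp).le (half_le_self hp.le), h1, two_mul]

theorem le_mul_norm (X : PlaneNorm) (v : ℂ) : X v ≤ (X 1 + X Complex.I) * ‖v‖ := by
  have h : v = v.re • (1 : ℂ) + v.im • Complex.I := by apply Complex.ext <;> simp
  have h1 := X.add_le (v.re • (1 : ℂ)) (v.im • Complex.I)
  rw [← h, map_smul, map_smul] at h1
  have h2 := mul_le_mul_of_nonneg_right (Complex.abs_re_le_norm v) (X.nonneg 1)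
  have h3 := mul_le_mul_of_nonneg_right (Complex.abs_im_le_norm v) (X.nonneg Complex.I)
  linarith

theorem abs_sub_le (X : PlaneNorm) (u v : ℂ) : |X u - X v| ≤ X (u - v) := by
  have h1 := X.add_le (u - v) v
  have h2 := X.add_le (v - u) u
  rw [sub_add_cancel] at h1 h2
  rw [X.map_sub_comm v u] at h2
  exact abs_sub_le_iff.2 ⟨by linarith, by linarith⟩

theorem lipschitzWith (X : PlaneNorm) :
    LipschitzWith (Real.toNNReal (X 1 + X Complex.I)) (fun v : ℂ => X v) :=
  LipschitzWith.of_dist_le' fun u v => by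
    rw [Real.dist_eq, dist_eq_norm]
    exact (X.abs_sub_le u v).trans (X.le_mul_norm _)

theorem exists_forall_mul_norm_le (X : PlaneNorm) :
    ∃ p : ℂ, ‖p‖ = 1 ∧ ∀ v, X p * ‖v‖ ≤ X v := by
  obtain ⟨p, hp, hmin⟩ := (isCompact_sphere (0 : ℂ) 1).exists_isMinOn ⟨1, by simp⟩
    X.lipschitzWith.continuous.continuousOn
  refine ⟨p, by simpa using hp, fun v => ?_⟩
  rcases eq_or_ne v 0 with rfl | hv
  · simp
  have hn : 0 < ‖v‖ := norm_pos_iff.2 hv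
  have h1 : X p ≤ X (‖v‖⁻¹ • v) := hmin (by simp [hn.ne'])
  rw [map_smul, abs_of_pos (inv_pos.2 hn)] at h1
  rwa [← le_div_iff₀ hn, div_eq_inv_mul]

/-- Convexity: on a segment the norm is at most its larger endpoint value. -/
theorem map_add_smul_le (X : PlaneNorm) {u w : ℂ} (h : X u ≤ X (u + w)) {c : ℝ} (h0 : 0 ≤ c)
    (h1 : c ≤ 1) : X (u + c • w) ≤ X (u + w) := by
  have h2 : u + c • w = (1 - c) • u + c • (u + w) := by
    rw [sub_smul, one_smul, smul_add]; ring
  have h3 := X.add_le ((1 - c) • u) (c • (u + w))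
  rw [← h2, map_smul, map_smul, abs_of_nonneg h0, abs_of_nonneg (sub_nonneg.2 h1)] at h3
  nlinarith

/-- The coordinates are bounded by |v| ≤ X(v), so dropping one coordinate to zero does not increase
the norm; convexity then gives monotonicity in that coordinate. One coordinate is moved at a time.
-/
theorem map_add_I_mono {X : PlaneNorm} (h1 : X 1 = 1) (hI : X Complex.I = 1)
    (hle : ∀ v : ℂ, ‖v‖ ≤ X v) {x y x' y' : ℝ} (hx : 0 ≤ x) (hy : 0 ≤ y) (hxx : x ≤ x')
    (hyy : y ≤ y') :
    X (x • (1 : ℂ) + y • Complex.I) ≤ X (x' • (1 : ℂ) + y' • Complex.I) := by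
  have key : ∀ u w : ℂ, X u = 1 → X w = 1 → (∀ a b : ℝ, |a| ≤ X (a • u + b • w)) →
      ∀ a b b' : ℝ, 0 ≤ b → b ≤ b' → X (a • u + b • w) ≤ X (a • u + b' • w) := by
    intro u w hu hw h a b b' hb hbb
    rcases hb.eq_or_lt with rfl | hb
    · rw [zero_smul, add_zero, map_smul, hu, mul_one]; exact h a b'
    · have hb' : 0 < b' := hb.trans_le hbb
      have := X.map_add_smul_le (u := a • u) (w := b' • w)
        (by rw [map_smul, hu, mul_one]; exact h a b') (c := b / b') (by positivity)
        ((div_le_one hb').2 hbb)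
      rwa [smul_smul, div_mul_cancel₀ _ hb'.ne'] at this
  have hre : ∀ a b : ℝ, |a| ≤ X (a • (1 : ℂ) + b • Complex.I) := fun a b =>
    le_trans (by simpa using Complex.abs_re_le_norm (a • (1 : ℂ) + b • Complex.I)) (hle _)
  have him : ∀ a b : ℝ, |b| ≤ X (a • (1 : ℂ) + b • Complex.I) := fun a b =>
    le_trans (by simpa using Complex.abs_im_le_norm (a • (1 : ℂ) + b • Complex.I)) (hle _)
  refine (key 1 Complex.I h1 hI hre x y y' hy hyy).trans ?_
  have := key Complex.I 1 hI h1 (fun a b => by rw [add_comm]; exact him b a) y' x x' hx hxx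
  rwa [add_comm, add_comm (y' • Complex.I)] at this

theorem exp_mul_I_eq_smul (t : ℝ) : Complex.exp (t * Complex.I) =
    Real.cos t • (1 : ℂ) + Real.sin t • Complex.I := by
  rw [Complex.exp_mul_I]; simp

theorem len_quarter_le_two {X : PlaneNorm} (h1 : X 1 = 1) (hI : X Complex.I = 1)
    (hle : ∀ v : ℂ, ‖v‖ ≤ X v) : X.len X.sphereLoop 0 (Real.pi / 2) ≤ 2 := by
  have hp := Real.pi_pos
  set g : ℝ → ℝ := fun t => X (Complex.exp (t * Complex.I)) with hg
  have hgpos : ∀ t, 0 < g t := fun t => X.pos (Complex.exp_ne_zero _)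
  have hsc : ∀ t c : ℝ, 0 ≤ c →
      c * g t = X ((c * Real.cos t) • (1 : ℂ) + (c * Real.sin t) • Complex.I) := fun t c hc => by
    rw [← smul_smul, ← smul_smul, ← smul_add, ← exp_mul_I_eq_smul, map_smul, abs_of_nonneg hc]
  have hcos : ∀ t ∈ Set.Icc 0 (Real.pi / 2), 0 ≤ Real.cos t := fun t ht =>
    Real.cos_nonneg_of_mem_Icc ⟨by linarith [ht.1], ht.2⟩
  have hsin : ∀ t ∈ Set.Icc 0 (Real.pi / 2), 0 ≤ Real.sin t := fun t ht =>
    Real.sin_nonneg_of_nonneg_of_le_pi ht.1 (by linarith [ht.2])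
  have hst : ∀ s ∈ Set.Icc 0 (Real.pi / 2), ∀ t ∈ Set.Icc 0 (Real.pi / 2), s ≤ t →
      Real.cos t * Real.sin s ≤ Real.cos s * Real.sin t := fun s hs t ht h => by
    have := Real.sin_nonneg_of_nonneg_of_le_pi (sub_nonneg.2 h) (by linarith [ht.2, hs.1])
    rw [Real.sin_sub] at this
    linarith
  have hx : AntitoneOn (fun t => Real.cos t / g t) (Set.Icc 0 (Real.pi / 2)) := by
    intro s hs t ht h
    change Real.cos t / g t ≤ Real.cos s / g s
    -- After cross-multiplication both sides are norms of first-quadrant vectors with equal first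
    -- coordinate; the second coordinates compare because sin(t - s) ≥ 0.
    rw [div_le_div_iff₀ (hgpos t) (hgpos s), hsc _ _ (hcos t ht), hsc _ _ (hcos s hs)]
    exact map_add_I_mono h1 hI hle (mul_nonneg (hcos t ht) (hcos s hs))
      (mul_nonneg (hcos t ht) (hsin s hs)) (mul_comm _ _).le (hst s hs t ht h)
  have hy : MonotoneOn (fun t => Real.sin t / g t) (Set.Icc 0 (Real.pi / 2)) := by
    intro s hs t ht h
    change Real.sin s / g s ≤ Real.sin t / g t
    rw [div_le_div_iff₀ (hgpos s) (hgpos t), hsc _ _ (hsin t ht), hsc _ _ (hsin s hs)]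
    refine map_add_I_mono h1 hI hle (mul_nonneg (hsin s hs) (hcos t ht))
      (mul_nonneg (hsin s hs) (hsin t ht)) ?_ (mul_comm _ _).le
    have := hst s hs t ht h
    linarith
  have hloop : ∀ t, X.sphereLoop t =
      (Real.cos t / g t) • (1 : ℂ) + (Real.sin t / g t) • Complex.I := fun t => by
    have : X.sphereLoop t = (g t)⁻¹ • Complex.exp (t * Complex.I) := rfl
    rw [this, exp_mul_I_eq_smul, smul_add, smul_smul, smul_smul, div_eq_inv_mul, div_eq_inv_mul]
  -- The majorant y - x rises from -1 at the point 1 to 1 at the point i, which gives the bound 2.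
  refine (len_le_of_monotoneOn X (M := fun t => Real.sin t / g t - Real.cos t / g t)
    (half_pos hp).le (fun s hs t ht h => sub_le_sub (hy hs ht h) (hx hs ht h)) ?_).trans ?_
  · intro s hs t ht h
    have e : X.sphereLoop t - X.sphereLoop s =
        (Real.cos t / g t - Real.cos s / g s) • (1 : ℂ) +
          (Real.sin t / g t - Real.sin s / g s) • Complex.I := by
      rw [hloop, hloop, sub_smul, sub_smul]; abel
    rw [e]
    refine (X.add_le _ _).trans ?_
    rw [map_smul, map_smul, h1, hI, mul_one, mul_one,
      abs_of_nonneg (sub_nonneg.2 (hy hs ht h)), abs_of_nonpos (sub_nonpos.2 (hx hs ht h))]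
    linarith
  · have g0 : g 0 = 1 := by simp [hg, h1]
    have g1 : g (Real.pi / 2) = 1 := by
      simp only [hg]
      push_cast
      rw [Complex.exp_pi_div_two_mul_I, hI]
    simp only [g0, g1, Real.cos_zero, Real.sin_zero, Real.cos_pi_div_two, Real.sin_pi_div_two]
    norm_num

theorem varpi_le_four {X : PlaneNorm} (h : ∀ v, X (Complex.I * v) = X v) : X.varpi ≤ 4 := by
  obtain ⟨p, hp, hmin⟩ := X.exists_forall_mul_norm_le
  have hp0 : p ≠ 0 := norm_pos_iff.1 (hp ▸ one_pos)
  have hXp := X.pos hp0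
  -- q is a point of the unit sphere farthest from the origin. Multiplication by q commutes with i,
  -- so pulling back along it keeps the symmetry and makes the norm dominate |·|.
  set q : ℂ := (X p)⁻¹ • p with hq
  have hq0 : q ≠ 0 := smul_ne_zero (inv_ne_zero hXp.ne') hp0
  have hXq : X q = 1 := by
    rw [hq, map_smul, abs_of_pos (inv_pos.2 hXp), inv_mul_cancel₀ hXp.ne']
  set T : ℂ ≃ₗ[ℝ] ℂ := (LinearEquiv.smulOfNeZero ℂ ℂ q hq0).restrictScalars ℝ with hT
  have hY : ∀ v, pushforward T.symm X v = X (q * v) := fun v => rfl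
  have hYI : ∀ v, pushforward T.symm X (Complex.I * v) = pushforward T.symm X v := fun v => by
    rw [hY, hY, mul_left_comm, h]
  have hY1 : pushforward T.symm X 1 = 1 := by rw [hY, mul_one, hXq]
  rw [← varpi_pushforward T.symm X, varpi_eq_two_mul_len hYI]
  have := len_quarter_le_two hY1 (by rw [← mul_one Complex.I, hYI, hY1]) (fun v => by
    have h2 := hmin (q * v)
    rw [norm_mul, hq, norm_smul, hp, Real.norm_of_nonneg (inv_pos.2 hXp).le, mul_one, ← mul_assoc,
      mul_inv_cancel₀ hXp.ne', one_mul] at h2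
    exact h2)
  calc 2 * _ ≤ (2 : ENNReal) * 2 := by gcongr
    _ = 4 := by norm_num

/-! ### The lower bound π and its equality case -/

/-- The left side is the derivative of X at e^{it} in the direction e^{it}(x + iy), which the
triangle inequality bounds by the norm of that direction. -/
theorem mul_add_mul_le_of_hasDerivAt (X : PlaneNorm) {t g' : ℝ}
    (hg : HasDerivAt (fun t : ℝ => X (Complex.exp (t * Complex.I))) g' t) (x y : ℝ) :
    x * X (Complex.exp (t * Complex.I)) + y * g' ≤
      X (Complex.exp (t * Complex.I) * (x + y * Complex.I)) := by
  set g : ℝ → ℝ := fun t : ℝ => X (Complex.exp (t * Complex.I)) with hgdef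
  set z : ℂ := x + y * Complex.I with hz
  -- The curve e^{it}e^{hz} has the required velocity at h = 0, and along it X is exactly e^{hx} g(t
  -- + hy), so only differentiability of g is needed.
  have hF : HasDerivAt (fun h : ℝ => Real.exp (h * x) * g (t + h * y)) (x * g t + y * g') 0 := by
    have h1 : HasDerivAt (fun h : ℝ => Real.exp (h * x)) x 0 := by
      simpa using ((hasDerivAt_id (0 : ℝ)).mul_const x).exp
    have h2 : HasDerivAt (fun h : ℝ => t + h * y) y 0 := by
      simpa using ((hasDerivAt_id (0 : ℝ)).mul_const y).const_add t
    have h3 : HasDerivAt (fun h : ℝ => g (t + h * y)) (g' * y) 0 :=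
      HasDerivAt.comp (0 : ℝ) (h₂ := g) (h := fun h : ℝ => t + h * y) (by simpa using hg) h2
    exact (h1.mul h3).congr_deriv (by simp [mul_comm])
  have hG : HasDerivAt (fun h : ℝ => Complex.exp (t * Complex.I) * Complex.exp ((h : ℂ) * z))
      (Complex.exp (t * Complex.I) * z) 0 := by
    have h1 : HasDerivAt (fun h : ℝ => (h : ℂ) * z) z 0 := by
      simpa using (Complex.ofRealCLM.hasDerivAt (x := (0 : ℝ))).mul_const z
    simpa using h1.cexp.const_mul (Complex.exp (t * Complex.I))
  have hGF : ∀ h : ℝ, X (Complex.exp (t * Complex.I) * Complex.exp ((h : ℂ) * z)) =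
      Real.exp (h * x) * g (t + h * y) := fun h => by
    have : Complex.exp (t * Complex.I) * Complex.exp ((h : ℂ) * z) =
        Real.exp (h * x) • Complex.exp (((t + h * y : ℝ) : ℂ) * Complex.I) := by
      rw [Complex.real_smul, Complex.ofReal_exp, ← Complex.exp_add, ← Complex.exp_add, hz]
      congr 1
      push_cast
      ring
    rw [this, map_smul, abs_of_pos (Real.exp_pos _)]
  refine le_of_tendsto_of_tendsto hF.tendsto_slope_zero_right
    ((X.lipschitzWith.continuous.tendsto _).comp hG.tendsto_slope_zero_right) ?_
  filter_upwards [self_mem_nhdsWithin] with h hh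
  have hh : 0 < h := hh
  simp only [Function.comp]
  rw [map_smul, abs_of_pos (inv_pos.2 hh), smul_eq_mul, ← hGF, ← hGF]
  exact mul_le_mul_of_nonneg_left ((le_abs_self _).trans (X.abs_sub_le _ _)) (inv_pos.2 hh).le

/-- The factor i is kept outside so that quarter-turn symmetry can discard it. -/
theorem hasDerivAt_sphereLoop (X : PlaneNorm) {t g' : ℝ}
    (hg : HasDerivAt (fun t : ℝ => X (Complex.exp (t * Complex.I))) g' t) :
    HasDerivAt X.sphereLoop (((X (Complex.exp (t * Complex.I)))⁻¹ ^ 2) •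
      (Complex.I * (Complex.exp (t * Complex.I) *
        (X (Complex.exp (t * Complex.I)) + g' * Complex.I)))) t := by
  have hpos := X.pos (Complex.exp_ne_zero (t * Complex.I))
  have h1 : HasDerivAt (fun t : ℝ => Complex.exp (t * Complex.I))
      (Complex.exp (t * Complex.I) * Complex.I) t := by
    simpa using ((Complex.ofRealCLM.hasDerivAt (x := t)).mul_const Complex.I).cexp
  refine ((hg.inv hpos.ne').smul h1).congr_deriv ?_
  have hc : ((X (Complex.exp (t * Complex.I)) : ℝ) : ℂ) ≠ 0 := by exact_mod_cast hpos.ne'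
  simp only [Complex.real_smul, Pi.inv_apply]
  push_cast
  field_simp
  linear_combination -(g' : ℂ) * Complex.I_sq

theorem one_add_sq_le_of_hasDerivAt {X : PlaneNorm} (hX : ∀ v, X (Complex.I * v) = X v)
    {V : ℝ → ℝ} {t g' V' : ℝ}
    (hg : HasDerivAt (fun t : ℝ => X (Complex.exp (t * Complex.I))) g' t)
    (hV : HasDerivAt V V' t)
    (hle : ∀ᶠ s in nhdsWithin t (Set.Ioi t), X (X.sphereLoop s - X.sphereLoop t) ≤ V s - V t) :
    1 + (g' / X (Complex.exp (t * Complex.I))) ^ 2 ≤ V' := by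
  have hpos := X.pos (Complex.exp_ne_zero (t * Complex.I))
  have hγ := X.hasDerivAt_sphereLoop hg
  have h1 : X _ ≤ V' := le_of_tendsto_of_tendsto
    ((X.lipschitzWith.continuous.tendsto _).comp hγ.tendsto_slope_zero_right)
    hV.tendsto_slope_zero_right (by
      have ht : Filter.Tendsto (fun h : ℝ => t + h) (nhdsWithin 0 (Set.Ioi 0))
          (nhdsWithin t (Set.Ioi t)) := by
        refine tendsto_nhdsWithin_iff.2 ⟨?_, ?_⟩
        · have : Filter.Tendsto (fun h : ℝ => t + h) (nhds 0) (nhds (t + 0)) :=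
            (continuous_const.add continuous_id).tendsto 0
          rw [add_zero] at this
          exact this.mono_left nhdsWithin_le_nhds
        · filter_upwards [self_mem_nhdsWithin] with h hh
          exact lt_add_of_pos_right t hh
      filter_upwards [ht.eventually hle, self_mem_nhdsWithin] with h hh hh0
      have hh0 : 0 < h := hh0
      simp only [Function.comp]
      rw [map_smul, abs_of_pos (inv_pos.2 hh0), smul_eq_mul]
      exact mul_le_mul_of_nonneg_left hh (inv_pos.2 hh0).le)
  rw [map_smul, abs_of_nonneg (sq_nonneg _), hX] at h1
  refine le_trans ?_ h1
  have h2 := X.mul_add_mul_le_of_hasDerivAt hg (X (Complex.exp (t * Complex.I))) g'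
  refine le_trans (le_of_eq ?_) (mul_le_mul_of_nonneg_left h2 (sq_nonneg _))
  field_simp

theorem lipschitzWith_exp_mul_I : LipschitzWith 1 (fun t : ℝ => Complex.exp (t * Complex.I)) := by
  refine lipschitzWith_of_nnnorm_deriv_le (𝕜 := ℝ) (fun t => ?_) (fun t => ?_)
  · fun_prop
  · have h1 : HasDerivAt (fun t : ℝ => Complex.exp (t * Complex.I))
        (Complex.exp (t * Complex.I) * Complex.I) t := by
      simpa using ((Complex.ofRealCLM.hasDerivAt (x := t)).mul_const Complex.I).cexp
    rw [h1.deriv, nnnorm_mul, Complex.nnnorm_I, mul_one]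
    exact (NNReal.coe_le_coe.1 (by simp))

open MeasureTheory in
/-- A real function growing at least as fast as the arc length of the unit sphere of a norm with
quarter-turn symmetry grows at least with unit speed on average, strictly faster unless the norm is
constant on the Euclidean unit circle. -/
theorem two_pi_le_of_sphereLoop_le {X : PlaneNorm} (hX : ∀ v, X (Complex.I * v) = X v)
    {V : ℝ → ℝ}
    (hV : ∀ s t, 0 ≤ s → s ≤ t → t ≤ 2 * Real.pi →
      X (X.sphereLoop t - X.sphereLoop s) ≤ V t - V s) :
    2 * Real.pi ≤ V (2 * Real.pi) - V 0 ∧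
    (V (2 * Real.pi) - V 0 ≤ 2 * Real.pi →
      ∃ c, ∀ t ∈ Set.Icc 0 (2 * Real.pi), X (Complex.exp (t * Complex.I)) = c) := by
  have hp := Real.two_pi_pos
  have hlip : LipschitzWith _ (fun t : ℝ => X (Complex.exp (t * Complex.I))) :=
    X.lipschitzWith.comp lipschitzWith_exp_mul_I
  have hmono : MonotoneOn V (Set.uIcc 0 (2 * Real.pi)) := by
    rw [Set.uIcc_of_le hp.le]
    exact fun s hs t ht h => sub_nonneg.1 ((X.nonneg _).trans (hV s t hs.1 h ht.2))
  have hint := hmono.intervalIntegrable_deriv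
  -- For a monotone function the integral of the derivative is at most the increment; absolute
  -- continuity of V is not needed.
  have hle := hmono.intervalIntegral_deriv_mem_uIcc
  have h0 : V 0 ≤ V (2 * Real.pi) := hmono Set.left_mem_uIcc Set.right_mem_uIcc hp.le
  rw [Set.uIcc_of_le (sub_nonneg.2 h0)] at hle
  have hae : ∀ᵐ t, t ∈ Set.Ioo 0 (2 * Real.pi) →
      HasDerivAt (fun t : ℝ => X (Complex.exp (t * Complex.I)))
        (deriv (fun t : ℝ => X (Complex.exp (t * Complex.I))) t) t ∧
      1 + (deriv (fun t : ℝ => X (Complex.exp (t * Complex.I))) t /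
        X (Complex.exp (t * Complex.I))) ^ 2 ≤ deriv V t := by
    filter_upwards [hlip.ae_differentiableAt, hmono.ae_differentiableWithinAt_of_mem]
      with t hg hVt ht
    rw [Set.uIcc_of_le hp.le] at hVt
    have hVt := ((hVt ⟨ht.1.le, ht.2.le⟩).differentiableAt (Icc_mem_nhds ht.1 ht.2)).hasDerivAt
    refine ⟨hg.hasDerivAt, one_add_sq_le_of_hasDerivAt hX hg.hasDerivAt hVt ?_⟩
    filter_upwards [Ioo_mem_nhdsGT ht.2] with s hs
    exact hV t s ht.1.le hs.1.le hs.2.le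
  have hae1 : ∀ᵐ t ∂(volume.restrict (Set.Ioc 0 (2 * Real.pi))), 0 ≤ deriv V t - 1 := by
    rw [← restrict_Ioo_eq_restrict_Ioc, ae_restrict_iff' measurableSet_Ioo]
    filter_upwards [hae] with t ht hm
    have h1 := (ht hm).2
    have h2 := sq_nonneg (deriv (fun t : ℝ => X (Complex.exp (t * Complex.I))) t /
        X (Complex.exp (t * Complex.I)))
    linarith
  have hint1 : IntervalIntegrable (fun t => deriv V t - 1) volume 0 (2 * Real.pi) :=
    hint.sub intervalIntegrable_const
  have heq : ∫ t in (0 : ℝ)..(2 * Real.pi), (deriv V t - 1) =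
      (∫ t in (0 : ℝ)..(2 * Real.pi), deriv V t) - 2 * Real.pi := by
    rw [intervalIntegral.integral_sub hint intervalIntegrable_const]
    simp
  have hnn : 0 ≤ ∫ t in (0 : ℝ)..(2 * Real.pi), (deriv V t - 1) := by
    rw [intervalIntegral.integral_of_le hp.le]
    exact integral_nonneg_of_ae hae1
  refine ⟨by linarith [hle.2], fun h => ?_⟩
  have hz : ∫ t in (0 : ℝ)..(2 * Real.pi), (deriv V t - 1) = 0 :=
    le_antisymm (by linarith [hle.2]) hnn
  rw [intervalIntegral.integral_of_le hp.le, integral_eq_zero_iff_of_nonneg_ae hae1 hint1.1,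
    ← restrict_Ioo_eq_restrict_Ioc] at hz
  have hz' := (ae_restrict_iff' measurableSet_Ioo).1 hz
  -- Equality forces V' = 1 and hence g' = 0 almost everywhere; g is Lipschitz, hence absolutely
  -- continuous, so it is constant.
  have := (hlip.lipschitzOnWith (s := Set.uIcc 0 (2 * Real.pi))).absolutelyContinuousOnInterval
    |>.const_of_ae_hasDerivAt_zero (by
      have hne0 : ∀ᵐ t : ℝ, t ≠ 0 := by simp [ae_iff]
      have hne1 : ∀ᵐ t : ℝ, t ≠ 2 * Real.pi := by simp [ae_iff]
      filter_upwards [hae, hz', hne0, hne1] with t ht hzt h0 h1 hm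
      rw [Set.uIcc_of_le hp.le] at hm
      have hm' : t ∈ Set.Ioo 0 (2 * Real.pi) := ⟨hm.1.lt_of_ne h0.symm, hm.2.lt_of_ne h1⟩
      obtain ⟨hd, h2⟩ := ht hm'
      have h3 : deriv V t - 1 = 0 := hzt hm'
      have h4 : (deriv (fun t : ℝ => X (Complex.exp (t * Complex.I))) t /
        X (Complex.exp (t * Complex.I))) ^ 2 = 0 := le_antisymm (by linarith) (sq_nonneg _)
      have hpos := X.pos (Complex.exp_ne_zero (t * Complex.I))
      rw [sq_eq_zero_iff, div_eq_zero_iff, or_iff_left hpos.ne'] at h4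
      rwa [h4] at hd)
  rwa [Set.uIcc_of_le hp.le] at this

theorem eq_mul_norm_of_forall_exp {X : PlaneNorm} {c : ℝ}
    (h : ∀ t ∈ Set.Icc 0 (2 * Real.pi), X (Complex.exp (t * Complex.I)) = c) :
    0 < c ∧ ∀ v : ℂ, X v = c * ‖v‖ := by
  have hp := Real.two_pi_pos
  refine ⟨h 0 ⟨le_rfl, hp.le⟩ ▸ X.pos (Complex.exp_ne_zero _), fun v => ?_⟩
  have hper : Function.Periodic (fun t : ℝ => X (Complex.exp (t * Complex.I))) (2 * Real.pi) :=
    fun t => by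
      simp only
      push_cast
      rw [add_mul, Complex.exp_add, Complex.exp_two_pi_mul_I, mul_one]
  obtain ⟨t, ht, hv⟩ := hper.exists_mem_Ico₀ hp v.arg
  have hv : X (Complex.exp (v.arg * Complex.I)) = c := hv.trans (h t ⟨ht.1, ht.2.le⟩)
  conv_lhs => rw [← Complex.norm_mul_exp_arg_mul_I v]
  rw [← Complex.real_smul, map_smul, hv, abs_of_nonneg (norm_nonneg v), mul_comm]

theorem pi_le_varpi_and {X : PlaneNorm} (hX : ∀ v, X (Complex.I * v) = X v) :
    ENNReal.ofReal Real.pi ≤ X.varpi ∧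
    (X.varpi = ENNReal.ofReal Real.pi → ∃ c : ℝ, 0 < c ∧ ∀ v : ℂ, X v = c * ‖v‖) := by
  have hp := Real.two_pi_pos
  -- The upper bound supplies the finiteness needed to use arc length as the real function V.
  have hfin : X.len X.sphereLoop 0 (2 * Real.pi) ≠ ⊤ := by
    intro h
    have h4 := varpi_le_four hX
    rw [varpi, h, ENNReal.top_div_of_ne_top ENNReal.ofNat_ne_top] at h4
    exact absurd h4 (by simp)
  have hadd : ∀ {s t : ℝ}, 0 ≤ s → s ≤ t →
      X.len X.sphereLoop 0 s + X.len X.sphereLoop s t = X.len X.sphereLoop 0 t :=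
    fun h0 h => len_add X _ h0 h
  have hfin' : ∀ t, 0 ≤ t → t ≤ 2 * Real.pi → X.len X.sphereLoop 0 t ≠ ⊤ := fun t h0 h =>
    ne_top_of_le_ne_top hfin (hadd h0 h ▸ le_self_add)
  obtain ⟨h1, h2⟩ := two_pi_le_of_sphereLoop_le hX
    (V := fun t => (X.len X.sphereLoop 0 t).toReal) (by
      intro s t h0 hst ht
      have hs := hfin' s h0 (hst.trans ht)
      have ht' := hfin' t (h0.trans hst) ht
      have hst' : X.len X.sphereLoop s t ≠ ⊤ :=
        ne_top_of_le_ne_top ht' (hadd h0 hst ▸ le_add_self)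
      rw [← hadd h0 hst, ENNReal.toReal_add hs hst', add_sub_cancel_left]
      exact (ENNReal.ofReal_le_iff_le_toReal hst').1 (X.le_len _ hst))
  simp only [len_self, ENNReal.toReal_zero, sub_zero] at h1 h2
  have he : X.varpi = ENNReal.ofReal ((X.len X.sphereLoop 0 (2 * Real.pi)).toReal / 2) := by
    rw [varpi, ENNReal.ofReal_div_of_pos two_pos, ENNReal.ofReal_toReal hfin]
    simp
  rw [he]
  refine ⟨ENNReal.ofReal_le_ofReal (by linarith), fun h => ?_⟩
  have h3 := (ENNReal.ofReal_eq_ofReal_iff (by positivity) Real.pi_pos.le).1 h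
  obtain ⟨c, hc⟩ := h2 (by linarith)
  exact ⟨c, eq_mul_norm_of_forall_exp hc⟩

/-- The factor c cancels, and a Euclidean chord is at most its arc. -/
theorem varpi_le_pi_of_eq_mul_norm {X : PlaneNorm} {c : ℝ} (hc : 0 < c)
    (h : ∀ v : ℂ, X v = c * ‖v‖) : X.varpi ≤ ENNReal.ofReal Real.pi := by
  rw [varpi_eq_len X 0, zero_add]
  refine (len_le_of_monotoneOn X (M := id) Real.pi_pos.le monotoneOn_id
    (fun s _ t _ hst => ?_)).trans_eq (by simp)
  have hl : ∀ t, X.sphereLoop t = c⁻¹ • Complex.exp (t * Complex.I) := fun t => by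
    rw [sphereLoop, h, Complex.norm_exp_ofReal_mul_I, mul_one]
  rw [hl, hl, ← smul_sub, map_smul, h, abs_of_pos (inv_pos.2 hc), ← mul_assoc,
    inv_mul_cancel₀ hc.ne', one_mul]
  have := lipschitzWith_exp_mul_I.dist_le_mul t s
  rwa [dist_eq_norm, Real.dist_eq, abs_of_nonneg (sub_nonneg.2 hst), NNReal.coe_one,
    one_mul] at this

theorem varpi_eq_pi_iff {X : PlaneNorm} (hX : ∀ v, X (Complex.I * v) = X v) :
    X.varpi = ENNReal.ofReal Real.pi ↔ ∃ c : ℝ, 0 < c ∧ ∀ v : ℂ, X v = c * ‖v‖ :=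
  ⟨(pi_le_varpi_and hX).2, fun ⟨_, hc, h⟩ =>
    le_antisymm (varpi_le_pi_of_eq_mul_norm hc h) (pi_le_varpi_and hX).1⟩

/-! ### Continuity of ϖ along the segment from ℓ² to ℓ¹ -/

/-- The norm `(1 - s) ℓ² + s ℓ¹`. -/
noncomputable def blend (s : unitInterval) : PlaneNorm where
  toSeminorm := Seminorm.of
    (fun v : ℂ => (1 - (s : ℝ)) * ‖v‖ + (s : ℝ) * (|v.re| + |v.im|))
    (fun u v => by
      have h1 := mul_le_mul_of_nonneg_left (norm_add_le u v) (sub_nonneg.2 s.2.2)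
      have h2 := mul_le_mul_of_nonneg_left
        (add_le_add (abs_add_le u.re v.re) (abs_add_le u.im v.im)) s.2.1
      simp only [Complex.add_re, Complex.add_im]
      linarith)
    (fun a v => by
      simp only [norm_smul, Complex.smul_re, Complex.smul_im, smul_eq_mul, abs_mul,
        Real.norm_eq_abs]
      ring)
  eq_zero_of_map_eq_zero' v h := by
    change (1 - (s : ℝ)) * ‖v‖ + (s : ℝ) * (|v.re| + |v.im|) = 0 at h
    have h1 := mul_le_mul_of_nonneg_left (Complex.norm_le_abs_re_add_abs_im v) s.2.1
    exact norm_le_zero_iff.1 (by linarith)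

theorem blend_apply (s : unitInterval) (v : ℂ) :
    blend s v = (1 - (s : ℝ)) * ‖v‖ + (s : ℝ) * (|v.re| + |v.im|) := rfl

theorem blend_I_mul (s : unitInterval) (v : ℂ) : blend s (Complex.I * v) = blend s v := by
  simp [blend_apply, add_comm]

theorem norm_le_blend (s : unitInterval) (v : ℂ) : ‖v‖ ≤ blend s v := by
  have h1 := mul_le_mul_of_nonneg_left (Complex.norm_le_abs_re_add_abs_im v) s.2.1
  rw [blend_apply]
  linarith

theorem blend_le_two_mul_norm (s : unitInterval) (v : ℂ) : blend s v ≤ 2 * ‖v‖ := by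
  have h1 := mul_le_mul_of_nonneg_left
    (add_le_add (Complex.abs_re_le_norm v) (Complex.abs_im_le_norm v)) s.2.1
  have h2 := mul_nonneg (sub_nonneg.2 s.2.2) (norm_nonneg v)
  rw [blend_apply]
  linarith

theorem blend_sub_blend_le (s r : unitInterval) (v : ℂ) :
    |blend s v - blend r v| ≤ |(s : ℝ) - r| * ‖v‖ := by
  have h1 := Complex.norm_le_abs_re_add_abs_im v
  have h2 := Complex.abs_re_le_norm v
  have h3 := Complex.abs_im_le_norm v
  have e : blend s v - blend r v = ((s : ℝ) - r) * (|v.re| + |v.im| - ‖v‖) := by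
    rw [blend_apply, blend_apply]; ring
  rw [e, abs_mul]
  exact mul_le_mul_of_nonneg_left (abs_le.2 ⟨by linarith, by linarith⟩) (abs_nonneg _)

theorem norm_exp_sub_exp_le (s t : ℝ) :
    ‖Complex.exp (t * Complex.I) - Complex.exp (s * Complex.I)‖ ≤ |t - s| := by
  have := lipschitzWith_exp_mul_I.dist_le_mul t s
  rwa [dist_eq_norm, Real.dist_eq, NNReal.coe_one, one_mul] at this

theorem abs_inv_sub_inv_le {a b c : ℝ} (ha : 1 ≤ a) (hb : 1 ≤ b) (h : |a - b| ≤ c) :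
    |a⁻¹ - b⁻¹| ≤ c := by
  have ha0 : 0 < a := by linarith
  have hb0 : 0 < b := by linarith
  rw [inv_sub_inv ha0.ne' hb0.ne', abs_div, abs_sub_comm, abs_of_pos (mul_pos ha0 hb0)]
  exact (div_le_self (abs_nonneg _) (by nlinarith)).trans h

/-- The product of two bounded Lipschitz functions, at a pair of points. -/
theorem norm_smul_sub_smul_le {a a' : ℝ} {v v' : ℂ} {A L B K d : ℝ} (ha : |a| ≤ A)
    (hv' : ‖v'‖ ≤ B) (haa : |a - a'| ≤ L * d) (hvv : ‖v - v'‖ ≤ K * d) :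
    ‖a • v - a' • v'‖ ≤ (A * K + L * B) * d := by
  have e : a • v - a' • v' = a • (v - v') + (a - a') • v' := by
    rw [smul_sub, sub_smul]; abel
  rw [e]
  refine (norm_add_le _ _).trans ?_
  rw [norm_smul, norm_smul, Real.norm_eq_abs, Real.norm_eq_abs]
  have h1 := mul_le_mul ha hvv (norm_nonneg _) ((abs_nonneg a).trans ha)
  have h2 := mul_le_mul haa hv' (norm_nonneg _) ((abs_nonneg _).trans haa)
  linarith

theorem norm_sphereLoop_blend_sub_le (s r : unitInterval) (t t' : ℝ) :
    ‖((blend s).sphereLoop t - (blend r).sphereLoop t) -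
      ((blend s).sphereLoop t' - (blend r).sphereLoop t')‖ ≤ 8 * |(s : ℝ) - r| * |t - t'| := by
  set e : ℝ → ℂ := fun t => Complex.exp (t * Complex.I) with he
  set k : ℝ → ℝ := fun t => |(e t).re| + |(e t).im| - 1 with hk
  have hn : ∀ t, ‖e t‖ = 1 := fun t => Complex.norm_exp_ofReal_mul_I t
  have h1 : ∀ s t, 1 ≤ blend s (e t) := fun s t => hn t ▸ norm_le_blend s (e t)
  have hl : ∀ t t', ‖e t - e t'‖ ≤ |t - t'| := fun t t' => norm_exp_sub_exp_le t' t
  have hgl : ∀ s t t', |blend s (e t) - blend s (e t')| ≤ 2 * |t - t'| := fun s t t' =>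
    ((blend s).abs_sub_le _ _).trans ((blend_le_two_mul_norm s _).trans (by linarith [hl t t']))
  have hi : ∀ s t, |(blend s (e t))⁻¹| ≤ 1 := fun s t => by
    rw [abs_of_nonneg (inv_nonneg.2 ((blend s).nonneg _))]
    exact inv_le_one_of_one_le₀ (h1 s t)
  have hil : ∀ s t t', |(blend s (e t))⁻¹ - (blend s (e t'))⁻¹| ≤ 2 * |t - t'| := fun s t t' =>
    abs_inv_sub_inv_le (h1 s t) (h1 s t') (hgl s t t')
  have hk1 : ∀ t, |k t| ≤ 1 := fun t => by
    have a1 := Complex.norm_le_abs_re_add_abs_im (e t)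
    have a2 := Complex.abs_re_le_norm (e t)
    have a3 := Complex.abs_im_le_norm (e t)
    rw [hn] at a1 a2 a3
    exact abs_le.2 ⟨by simp only [hk]; linarith, by simp only [hk]; linarith⟩
  have hkl : ∀ t t', |k t - k t'| ≤ 2 * |t - t'| := fun t t' => by
    have h := hgl 1 t t'
    simp only [blend_apply, Set.Icc.coe_one, sub_self, zero_mul, one_mul, zero_add] at h
    simpa [hk] using h
  -- On the unit circle the blend with parameter s equals 1 + sk, so the difference of the two
  -- reciprocals is explicit, with the factor r - s in front of bounded Lipschitz functions.
  have hform : ∀ t, (blend s).sphereLoop t - (blend r).sphereLoop t =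
      ((r : ℝ) - s) • (blend s (e t))⁻¹ • (blend r (e t))⁻¹ • k t • e t := fun t => by
    have a1 : blend s (e t) ≠ 0 := (one_pos.trans_le (h1 s t)).ne'
    have a2 : blend r (e t) ≠ 0 := (one_pos.trans_le (h1 r t)).ne'
    change (blend s (e t))⁻¹ • e t - (blend r (e t))⁻¹ • e t = _
    rw [← sub_smul, smul_smul, smul_smul, smul_smul, inv_sub_inv a1 a2]
    congr 1
    have e1 : blend r (e t) - blend s (e t) = ((r : ℝ) - s) * k t := by
      rw [blend_apply, blend_apply, hn]; simp only [hk]; ring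
    rw [e1]
    field_simp
  have hd := abs_nonneg (t - t')
  have b1 : ∀ t, ‖k t • e t‖ ≤ 1 := fun t => by
    rw [norm_smul, hn, mul_one]; exact hk1 t
  have b2 : ∀ t, ‖(blend r (e t))⁻¹ • k t • e t‖ ≤ 1 := fun t => by
    rw [norm_smul]; exact mul_le_one₀ (hi r t) (norm_nonneg _) (b1 t)
  have c1 := norm_smul_sub_smul_le (hk1 t) (hn t').le (hkl t t')
    ((hl t t').trans_eq (one_mul _).symm)
  have c2 := norm_smul_sub_smul_le (hi r t) (b1 t') (hil r t t') c1
  have c3 := norm_smul_sub_smul_le (hi s t) (b2 t') (hil s t t') c2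
  rw [hform, hform, ← smul_sub, norm_smul, Real.norm_eq_abs, abs_sub_comm]
  have c4 := mul_le_mul_of_nonneg_left c3 (abs_nonneg ((s : ℝ) - r))
  -- The successive Lipschitz constants are 3, 5 and 7, rounded up to 8.
  nlinarith [mul_nonneg (abs_nonneg ((s : ℝ) - r)) hd]

theorem varpi_toReal_blend_le (s r : unitInterval) :
    (blend s).varpi.toReal ≤ (blend r).varpi.toReal + (4 + 32 * Real.pi) * |(s : ℝ) - r| := by
  set d : ℝ := |(s : ℝ) - r| with hd
  have hd0 : 0 ≤ d := abs_nonneg _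
  have hp := Real.pi_pos
  have hfin : ∀ s, (blend s).varpi ≠ ⊤ := fun s =>
    ne_top_of_le_ne_top ENNReal.ofNat_ne_top (varpi_le_four (blend_I_mul s))
  -- Changing the norm costs a factor 1 + d; moving the loop costs at most 2 · 8d per unit of angle,
  -- hence M(t) = 16dt.
  have key := len_le_of_forall (blend r) (blend s) (φ := (blend r).sphereLoop)
    (ψ := (blend s).sphereLoop) (M := fun t => 16 * d * t) (K := 1 + d) hp.le
    (fun a _ b _ h => mul_le_mul_of_nonneg_left h (by positivity)) (by positivity)
    (fun a _ b _ hab => by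
      set u := (blend r).sphereLoop b - (blend r).sphereLoop a with hu
      set w := ((blend s).sphereLoop b - (blend r).sphereLoop b) -
        ((blend s).sphereLoop a - (blend r).sphereLoop a) with hw
      have e : (blend s).sphereLoop b - (blend s).sphereLoop a = u + w := by
        rw [hu, hw]; ring
      rw [e]
      have h1 := (blend s).add_le u w
      have h2 := (le_abs_self _).trans (blend_sub_blend_le s r u)
      have h3 := mul_le_mul_of_nonneg_left (norm_le_blend r u) hd0
      have h4 := blend_le_two_mul_norm s w
      have h5 := norm_sphereLoop_blend_sub_le s r b a
      rw [← hw, abs_of_nonneg (sub_nonneg.2 hab)] at h5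
      linarith)
  rw [← zero_add Real.pi, ← varpi_eq_len, ← varpi_eq_len, zero_add, mul_zero, sub_zero] at key
  have h4 : (blend r).varpi.toReal ≤ 4 := by
    have := ENNReal.toReal_mono ENNReal.ofNat_ne_top (varpi_le_four (blend_I_mul r))
    simpa using this
  have key' := ENNReal.toReal_mono (ENNReal.add_ne_top.2
    ⟨ENNReal.mul_ne_top ENNReal.ofReal_ne_top (hfin r), ENNReal.ofReal_ne_top⟩) key
  rw [ENNReal.toReal_add (ENNReal.mul_ne_top ENNReal.ofReal_ne_top (hfin r)) ENNReal.ofReal_ne_top,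
    ENNReal.toReal_mul, ENNReal.toReal_ofReal (by positivity),
    ENNReal.toReal_ofReal (by positivity)] at key'
  nlinarith [mul_nonneg hp.le hd0]

theorem continuous_varpi_toReal_blend : Continuous fun s => (blend s).varpi.toReal := by
  refine (LipschitzWith.of_dist_le' (K := 4 + 32 * Real.pi) fun s r => ?_).continuous
  rw [Real.dist_eq, Subtype.dist_eq, Real.dist_eq]
  refine abs_sub_le_iff.2 ⟨?_, ?_⟩
  · linarith [varpi_toReal_blend_le s r]
  · have := varpi_toReal_blend_le r s
    rw [abs_sub_comm] at this
    linarith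

theorem varpi_blend_zero : (blend 0).varpi = ENNReal.ofReal Real.pi :=
  (varpi_eq_pi_iff (blend_I_mul 0)).2 ⟨1, one_pos, fun v => by simp [blend_apply]⟩

theorem varpi_blend_one : (blend 1).varpi = 4 := by
  refine le_antisymm (varpi_le_four (blend_I_mul 1)) ?_
  have hp := Real.pi_pos
  -- For ℓ¹ the single chord from 1 to i already has length 2.
  have h := (blend 1).le_len (blend 1).sphereLoop (half_pos hp).le
  have e : blend 1 ((blend 1).sphereLoop (Real.pi / 2) - (blend 1).sphereLoop 0) = 2 := by
    have h1 : (blend 1).sphereLoop 0 = 1 := by simp [sphereLoop, blend_apply]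
    have h2 : (blend 1).sphereLoop (Real.pi / 2) = Complex.I := by
      rw [sphereLoop]
      push_cast
      rw [Complex.exp_pi_div_two_mul_I]
      simp [blend_apply]
    rw [h1, h2]
    simp [blend_apply]
    norm_num
  rw [e] at h
  rw [varpi_eq_two_mul_len (blend_I_mul 1)]
  calc (4 : ENNReal) = 2 * ENNReal.ofReal 2 := by
        rw [ENNReal.ofReal_ofNat]; norm_num
    _ ≤ _ := by gcongr

theorem exists_blend_varpi_eq {x : ENNReal} (h1 : ENNReal.ofReal Real.pi ≤ x) (h2 : x ≤ 4) :
    ∃ s, (blend s).varpi = x := by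
  have hx : x ≠ ⊤ := ne_top_of_le_ne_top ENNReal.ofNat_ne_top h2
  have h3 : (blend 0).varpi.toReal ≤ x.toReal := by
    rw [varpi_blend_zero]; exact ENNReal.toReal_mono hx h1
  have h4 : x.toReal ≤ (blend 1).varpi.toReal := by
    rw [varpi_blend_one]; exact ENNReal.toReal_mono ENNReal.ofNat_ne_top h2
  obtain ⟨s, hs⟩ := mem_range_of_exists_le_of_exists_ge continuous_varpi_toReal_blend
    ⟨0, h3⟩ ⟨1, h4⟩
  exact ⟨s, (ENNReal.toReal_eq_toReal_iff' (ne_top_of_le_ne_top ENNReal.ofNat_ne_top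
    (varpi_le_four (blend_I_mul s))) hx).1 hs⟩

/-! ### Values of ϖ on 𝒬 and the Euclidean norms -/

theorem linearlyEquivalent_refl (X : PlaneNorm) : LinearlyEquivalent X X :=
  ⟨LinearEquiv.refl ℝ ℂ, ext fun _ => rfl⟩

theorem image_varpi_quarterTurnClass :
    varpi '' quarterTurnClass = Set.Icc (ENNReal.ofReal Real.pi) 4 := by
  ext x
  constructor
  · rintro ⟨Y, ⟨X, hX, hYX⟩, rfl⟩
    rw [hYX.varpi_eq]
    exact ⟨(pi_le_varpi_and hX.map_I_mul).1, varpi_le_four hX.map_I_mul⟩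
  · rintro ⟨h1, h2⟩
    obtain ⟨s, hs⟩ := exists_blend_varpi_eq h1 h2
    exact ⟨blend s, ⟨blend s, hasQuarterTurnSymmetry_of_forall (blend_I_mul s),
      linearlyEquivalent_refl _⟩, hs⟩

/-- Completing the square: B(v, v) = (√a x + (b/√a) y)² + (c - b²/a) y², with the last coefficient
nonnegative as the value of B at i - b/a. -/
theorem exists_linearEquiv_norm_sq_eq (B : LinearMap.BilinForm ℝ ℂ) (hB : ∀ u v, B u v = B v u)
    (hpos : ∀ v, v ≠ 0 → 0 < B v v) : ∃ T : ℂ ≃ₗ[ℝ] ℂ, ∀ v, ‖T v‖ ^ 2 = B v v := by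
  set a := B 1 1 with ha
  set b := B 1 Complex.I with hb
  set c := B Complex.I Complex.I with hc
  have ha0 : 0 < a := hpos 1 one_ne_zero
  have hexp : ∀ x y : ℝ, B (x • (1 : ℂ) + y • Complex.I) (x • (1 : ℂ) + y • Complex.I) =
      x ^ 2 * a + 2 * x * y * b + y ^ 2 * c := fun x y => by
    simp only [map_add, LinearMap.map_smul, LinearMap.add_apply, LinearMap.smul_apply, smul_eq_mul,
      hB Complex.I 1, ← ha, ← hb, ← hc]
    ring
  have hdet : 0 ≤ c - b ^ 2 / a := by
    have h1 := hpos ((-(b / a)) • (1 : ℂ) + (1 : ℝ) • Complex.I) (fun h => by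
      have := congrArg Complex.im h
      simp at this)
    rw [hexp] at h1
    have : (-(b / a)) ^ 2 * a + 2 * -(b / a) * 1 * b + 1 ^ 2 * c = c - b ^ 2 / a := by
      field_simp
      ring
    linarith
  let L : ℂ →ₗ[ℝ] ℂ :=
    Complex.reLm.smulRight ((√a : ℝ) : ℂ) +
      Complex.imLm.smulRight (((b / √a : ℝ) : ℂ) + (√(c - b ^ 2 / a) : ℝ) * Complex.I)
  have hs : √a ≠ 0 := (Real.sqrt_pos.2 ha0).ne'
  have hL : ∀ v, ‖L v‖ ^ 2 = B v v := fun v => by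
    have hv : v = v.re • (1 : ℂ) + v.im • Complex.I := by apply Complex.ext <;> simp
    have hre : (L v).re = v.re * √a + v.im * (b / √a) := by simp [L]
    have him : (L v).im = v.im * √(c - b ^ 2 / a) := by simp [L]
    conv_rhs => rw [hv]
    rw [hexp, ← Complex.normSq_eq_norm_sq, Complex.normSq_apply, hre, him]
    have e1 := Real.mul_self_sqrt ha0.le
    have e2 := Real.mul_self_sqrt hdet
    have e3 : √a * (b / √a) = b := by field_simp
    have e4 : (b / √a) * (b / √a) = b ^ 2 / a := by
      rw [div_mul_div_comm, e1, sq]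
    linear_combination v.re ^ 2 * e1 + v.im ^ 2 * e2 + 2 * v.re * v.im * e3 + v.im ^ 2 * e4
  refine ⟨LinearEquiv.ofInjectiveEndo L ((injective_iff_map_eq_zero L).2 fun v hv => ?_), hL⟩
  by_contra h0
  have h1 := hpos v h0
  rw [← hL, hv, norm_zero] at h1
  norm_num at h1

theorem euclideanNorms_eq :
    euclideanNorms = {X | X ∈ quarterTurnClass ∧ X.varpi = ENNReal.ofReal Real.pi} := by
  ext X
  constructor
  · rintro ⟨B, hB, hpos, hX⟩
    obtain ⟨T, hT⟩ := exists_linearEquiv_norm_sq_eq B hB hpos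
    have hl : ∀ v, l2 (Complex.I * v) = l2 v := fun v => by
      change ‖Complex.I * v‖ = ‖v‖
      simp
    have he : LinearlyEquivalent X l2 := ⟨T, ext fun v => by
      change X (T.symm v) = ‖v‖
      rw [hX, ← hT, T.apply_symm_apply, Real.sqrt_sq (norm_nonneg v)]⟩
    refine ⟨⟨l2, hasQuarterTurnSymmetry_of_forall hl, he⟩, ?_⟩
    rw [he.varpi_eq]
    exact (varpi_eq_pi_iff hl).2 ⟨1, one_pos, fun v => (one_mul _).symm⟩
  · rintro ⟨⟨Y, hY, T, rfl⟩, h⟩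
    rw [← varpi_pushforward T X] at h
    obtain ⟨c, hc, hYc⟩ := (varpi_eq_pi_iff hY.map_I_mul).1 h
    have hX : ∀ v, X v = c * ‖T v‖ := fun v => by rw [← hYc, pushforward_apply]
    -- The inner product is the standard one pulled back by T and scaled by c², since X(v) = c|Tv|.
    have hB : ∀ v, ((c ^ 2) • (innerₗ ℂ).compl₁₂ T.toLinearMap T.toLinearMap :
        LinearMap.BilinForm ℝ ℂ) v v = (c * ‖T v‖) ^ 2 := fun v => by
      simp [mul_pow]
    refine ⟨(c ^ 2) • (innerₗ ℂ).compl₁₂ T.toLinearMap T.toLinearMap, fun u v => ?_,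
      fun v hv => ?_, fun v => ?_⟩
    · simp [real_inner_comm]
    · have : T v ≠ 0 := by simpa using hv
      rw [hB]
      positivity
    · rw [hB, hX, Real.sqrt_sq (by positivity)]

end PlaneNorm

theorem proposition3p3 :
    (∀ X : PlaneNorm, X.HasQuarterTurnSymmetry →
      ENNReal.ofReal Real.pi ≤ X.varpi ∧
      (X.varpi = ENNReal.ofReal Real.pi ↔
        ∃ c : ℝ, 0 < c ∧ ∀ v : ℂ, X v = c * PlaneNorm.l2 v)) ∧
    (PlaneNorm.varpi '' PlaneNorm.quarterTurnClass = Set.Icc (ENNReal.ofReal Real.pi) 4 ∧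
      PlaneNorm.euclideanNorms =
        {X | X ∈ PlaneNorm.quarterTurnClass ∧ X.varpi = ENNReal.ofReal Real.pi}) :=
  ⟨fun _ hX => ⟨(PlaneNorm.pi_le_varpi_and hX.map_I_mul).1,
    PlaneNorm.varpi_eq_pi_iff hX.map_I_mul⟩,
    PlaneNorm.image_varpi_quarterTurnClass, PlaneNorm.euclideanNorms_eq⟩
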